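/- **Setting.** Let $\mathcal N$ be a network: a finite directed acyclic multigraph with vertex set $\mathcal V$ and edge set $\mathcal E$, pairwise distinct source nodes $\sigma_1,\dots,\sigma_s$ without incoming edges, and a sink $\gamma\notin\{\sigma_1,\dots,\sigma_s\}$ to which every other vertex has a directed path. A cut of $\mathcal N$ is an edge set $C\subseteq\mathcal E$ whose removal leaves no directed path from $\sigma_i$ to $\gamma$ for at least one $i$; let $C_{\min}$ be the minimum size of a cut. For $r\ge 0$ let $\mathcal W_r=\{W\subseteq\mathcal E:|W|\le r\}$. Let $\mathbb F_q$ be a finite field. In an $(\ell,n)$ linear network code over $\mathbb F_q$ with key lengths $z_1,\dots,z_s$, the source $\sigma_i$ holds a message $\mathbf m_i\in\mathbb F_q^{\ell}$ and a key $\mathbf k_i\in\mathbb F_q^{z_i}$. Every edge $e$ carries a vector $\mathbf y_e\in\mathbb F_q^{1\times n}$: if $\mathrm{tail}(e)=\sigma_i$, then $\mathbf y_e=\sum_{j=1}^{\ell} m_{ij}\mathbf a_{(i,j),e}+\sum_{j=1}^{z_i}k_{ij}\mathbf b_{(i,j),e}$; otherwise $\mathbf y_e=\sum_{d:\,\mathrm{head}(d)=\mathrm{tail}(e)}\mathbf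 y_d\mathbf A_{d,e}$, with fixed coefficient vectors $\mathbf a_{(i,j),e},\mathbf b_{(i,j),e}\in\mathbb F_q^{1\times n}$ and matrices $\mathbf A_{d,e}\in\mathbb F_q^{n\times n}$. The code computes the algebraic sum if some decoding function recovers $\sum_{i=1}^s\mathbf m_i$ from $(\mathbf y_e)_{\mathrm{head}(e)=\gamma}$ for all messages and keys. For $\mathbf G\in\mathbb F_q^{s\times t}$ and $g(\mathbf x)=\mathbf x\mathbf G$, an $(\ell,n)$ linear network code is secure for $(\mathcal N,f,g,r)$, where $f(\mathbf x)=\sum_{i=1}^s x_i$, if it computes the algebraic sum and $I\big((Y_e)_{e\in W};\,(g(M_{1,j},\dots,M_{s,j}))_{j=1}^{\ell}\big)=0$ for all $W\in\mathcal W_r$, where $M_i$ and $K_i$ denote the random messages and keys, all their symbols are independent and uniform on $\mathbb F_q$, and $Y_e$ is the resulting random vector on the edge $e$. **Theorem.** Let $g(\mathbf x)=\mathbf x\mathbf G$ with $\mathbf G\in\mathbb F_q^{s\times t}$, $\mathbf G\ne\mathbf 0$, $r_g=\operatorname{rank}\mathbf G$, and let $0\le r\le C_{\min}$. Suppose $q>r_g\,|\mathcal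 W_r|$ and, in case $r=0$, also $q\ge s$. Then there is a $(C_{\min}-r,1)$ linear network code over $\mathbb F_q$ that is secure for $(\mathcal N,f,g,r)$. Moreover, it can be chosen with $r$ key symbols at each source and of the following form: there are a $(C_{\min},1)$ linear network code without keys that computes the algebraic sum, with messages $\mathbf u_e(\mathbf x_1,\dots,\mathbf x_s)$ for $\mathbf x_i\in\mathbb F_q^{C_{\min}}$, and an invertible matrix $\mathbf B\in\mathbb F_q^{C_{\min}\times C_{\min}}$, such that the messages of the secure code are $\mathbf y_e=\mathbf u_e\big((\mathbf m_1\,\mathbf k_1)\mathbf B,\dots,(\mathbf m_s\,\mathbf k_s)\mathbf B\big)$ for every edge $e$, i.e. its global encoding vectors are those of the non-secure code multiplied by $\widehat{\mathbf B}=\operatorname{diag}(\mathbf B,\dots,\mathbf B)$. -/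

import Mathlib

/-- A directed acyclic multigraph with vertex type `V` and edge type `E`, together with `s` distinct
source nodes without incoming edges and a sink that is not a source and can be reached from every
other vertex. -/
structure Network (V E : Type*) (s : ℕ) where
  tail : E → V
  head : E → V
  /-- the source nodes `σ₁, …, σₛ` (pairwise distinct) -/
  src : Fin s ↪ V
  sink : V
  src_ne_sink : ∀ i, src i ≠ sink
  /-- there is no directed path from a vertex to itself -/
  acyclic : ∀ v, ¬ Relation.TransGen (fun u w => ∃ e, tail e = u ∧ head e = w) v v
  head_ne_src : ∀ e i, head e ≠ src i
  reaches_sink : ∀ v, v ≠ sink →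
    Relation.TransGen (fun u w => ∃ e, tail e = u ∧ head e = w) v sink

namespace Network

variable {V E : Type*} {s : ℕ}

/-- There is a directed path (a nonempty sequence of consecutive edges) from `u` to `v` none of
whose edges lies in `C`. -/
def PathAvoiding (N : Network V E s) (C : Finset E) (u v : V) : Prop :=
  Relation.TransGen (fun a b => ∃ e, e ∉ C ∧ N.tail e = a ∧ N.head e = b) u v

/-- `C` is a cut of the network: it separates the sink from at least one source node. -/
def IsCut (N : Network V E s) (C : Finset E) : Prop :=
  ∃ i, ¬ N.PathAvoiding C (N.src i) N.sink

/-- The minimum size of a cut of the network. -/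
noncomputable def cMin (N : Network V E s) : ℕ :=
  sInf {c | ∃ C : Finset E, N.IsCut C ∧ C.card = c}

/-- `d` enters the node that `e` leaves. -/
def Feeds (N : Network V E s) (d e : E) : Prop := N.head d = N.tail e

theorem feeds_wf [Finite E] (N : Network V E s) : WellFounded N.Feeds := by
  have key : ∀ d e, Relation.TransGen N.Feeds d e →
      Relation.TransGen (fun u w => ∃ e, N.tail e = u ∧ N.head e = w) (N.tail d) (N.tail e) := by
    intro d e h
    exact h.lift N.tail fun a b hab => ⟨a, rfl, hab⟩
  have : IsTrans E (Relation.TransGen N.Feeds) := ⟨fun _ _ _ => Relation.TransGen.trans⟩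
  have : Std.Irrefl (Relation.TransGen N.Feeds) := ⟨fun e h => N.acyclic _ (key e e h)⟩
  exact Subrelation.wf (fun h => Relation.TransGen.single h)
    (Finite.wellFounded_of_trans_of_irrefl (Relation.TransGen N.Feeds))

end Network

/-- The family of all edge sets of size at most `r`. -/
def wiretapSets (E : Type*) [Fintype E] (r : ℕ) : Finset (Finset E) :=
  Finset.univ.filter fun W => W.card ≤ r

/-- An `(ℓ, n)` linear network code over `F` in which the source `σᵢ` has `ℓ` message symbols and
`z i` key symbols. Only the entries `msgCoeff i j e`, `keyCoeff i j e` with `tail e = σᵢ` and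
`edgeCoeff d e` with `head d = tail e` are ever used. -/
structure LinearCode {V E : Type*} {s : ℕ} (N : Network V E s) (F : Type*) (ℓ n : ℕ)
    (z : Fin s → ℕ) where
  msgCoeff : (i : Fin s) → Fin ℓ → E → Fin n → F
  keyCoeff : (i : Fin s) → Fin (z i) → E → Fin n → F
  edgeCoeff : E → E → Matrix (Fin n) (Fin n) F

/-- The mutual information (in nats) of two finitely valued random variables on a probability
space with law `P`, with the convention `0 log 0 = 0`. -/
noncomputable def mutualInfo {Ω α β : Type*} [Fintype α] [Fintype β] (P : PMF Ω)
    (X : Ω → α) (Y : Ω → β) : ℝ :=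
  ∑ x, ∑ y, ((P.map fun ω => (X ω, Y ω)) (x, y)).toReal *
    Real.log (((P.map fun ω => (X ω, Y ω)) (x, y)).toReal /
      (((P.map X) x).toReal * ((P.map Y) y).toReal))

namespace LinearCode

variable {V E : Type*} [Fintype E] {s : ℕ} {N : Network V E s} {F : Type*} [Field F] {ℓ n : ℕ}
  {z : Fin s → ℕ}

open Classical in
/-- The message `y_e` transmitted on the edge `e` when the sources hold the messages `m` and the
keys `k`, computed by recursion along the acyclic network. For an edge that leaves a source the
second sum is empty; for every other edge the first one is. -/
noncomputable def edgeMsg (C : LinearCode N F ℓ n z) (m : Fin s → Fin ℓ → F)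
    (k : (i : Fin s) → Fin (z i) → F) : E → Fin n → F :=
  N.feeds_wf.fix fun e y =>
    (∑ i with N.src i = N.tail e,
      (∑ j, m i j • C.msgCoeff i j e + ∑ j, k i j • C.keyCoeff i j e)) +
    ∑ d : {d // N.Feeds d e}, Matrix.vecMul (y d.1 d.2) (C.edgeCoeff d.1 e)

open Classical in
theorem edgeMsg_eq (C : LinearCode N F ℓ n z) (m : Fin s → Fin ℓ → F)
    (k : (i : Fin s) → Fin (z i) → F) (e : E) :
    C.edgeMsg m k e =
      (∑ i with N.src i = N.tail e,
        (∑ j, m i j • C.msgCoeff i j e + ∑ j, k i j • C.keyCoeff i j e)) +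
      ∑ d : {d // N.Feeds d e}, Matrix.vecMul (C.edgeMsg m k d.1) (C.edgeCoeff d.1 e) :=
  N.feeds_wf.fix_eq _ e

theorem edgeMsg_of_src (C : LinearCode N F ℓ n z) (m : Fin s → Fin ℓ → F)
    (k : (i : Fin s) → Fin (z i) → F) (e : E) (i : Fin s) (h : N.tail e = N.src i) :
    C.edgeMsg m k e = ∑ j, m i j • C.msgCoeff i j e + ∑ j, k i j • C.keyCoeff i j e := by
  classical
  rw [edgeMsg_eq]
  have : IsEmpty {d // N.Feeds d e} := ⟨fun d => N.head_ne_src d.1 i (d.2.trans h)⟩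
  simp [h, Finset.filter_eq']

open Classical in
theorem edgeMsg_of_not_src (C : LinearCode N F ℓ n z) (m : Fin s → Fin ℓ → F)
    (k : (i : Fin s) → Fin (z i) → F) (e : E) (h : ∀ i, N.tail e ≠ N.src i) :
    C.edgeMsg m k e =
      ∑ d with N.head d = N.tail e, Matrix.vecMul (C.edgeMsg m k d) (C.edgeCoeff d e) := by
  rw [edgeMsg_eq, Finset.filter_false_of_mem fun i _ => (h i).symm, Finset.sum_empty, zero_add]
  exact (Finset.sum_subtype (p := fun d => N.Feeds d e) _ (by simp [Network.Feeds])
    (fun d => Matrix.vecMul (C.edgeMsg m k d) (C.edgeCoeff d e))).symm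

/-- The sink can compute, for all messages and keys, the `ℓ` values of the target function `f`
from the messages on its incoming edges. -/
def Decodable {O : Type*} (C : LinearCode N F ℓ n z) (f : (Fin s → F) → O) : Prop :=
  ∃ φ : ({e // N.head e = N.sink} → Fin n → F) → Fin ℓ → O,
    ∀ (m : Fin s → Fin ℓ → F) (k : (i : Fin s) → Fin (z i) → F),
      φ (fun e => C.edgeMsg m k e.1) = fun j => f fun i => m i j

open Classical in
/-- For every wiretap set `W ∈ 𝒲`, the messages on `W` have zero mutual information with the `ℓ`
values of the security function `g`, when all message and key symbols are independent and uniformly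
distributed over `F`. -/
def FunctionSecure {Q : Type*} [Fintype Q] [Fintype F] (C : LinearCode N F ℓ n z)
    (g : (Fin s → F) → Q) (𝒲 : Finset (Finset E)) : Prop :=
  ∀ W ∈ 𝒲,
    mutualInfo
      (PMF.uniformOfFintype ((Fin s → Fin ℓ → F) × ((i : Fin s) → Fin (z i) → F)))
      (fun ω => fun e : {e // e ∈ W} => C.edgeMsg ω.1 ω.2 e.1)
      (fun ω => fun j => g fun i => ω.1 i j) = 0

end LinearCode

/-!
The code is built in two steps: a code without keys that computes the sum at rate `c = cMin`, and an
invertible change of the source coordinates, `r` of which are then used for keys.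

*Computing the sum.* Give every edge `e` a vector `h e` in `F ^ c`, meant as the weight of the symbol
on `e` in the final sum, such that `h d` is a combination of the `h e` with `tail e = head d` unless
`d` enters the sink. If the coefficients of these combinations are used for coding inside the
network, the weighted sum over the edges into the sink equals the weighted sum over what the sources
inject, and the sources can make the latter equal to the sum of their messages provided that the
vectors on the outgoing edges of each source span `F ^ c`
(`LinearCode.exists_decodable_of_edge_vectors`). Such vectors are chosen edge by edge, starting at
the sink (`Network.exists_edge_vectors`). The invariant is that each vertex set `X` that contains
a source and not the sink has capacity at least `c`, where the edges with a vector contribute the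
dimension of the span of the vectors on those with tail in `X`, and the others are counted if they
leave `X`. For the empty assignment this is the definition of `cMin`; for a full one and
`X = {σᵢ}` it is the spanning property. The capacity is submodular, so for each source the vectors
that would violate the invariant lie in one proper subspace; as `s ≤ |F|`, these `s` subspaces can be
avoided. That `s ≤ |F|` is a hypothesis if `r = 0`; otherwise it holds because each source has an
outgoing edge, whence `s ≤ |W_r| < |F|`.

*Security.* The edges of a wiretap set `W` observe functionals that span a space of dimension at most
`r`. As `|W_r| < |F|`, one can choose key rows `b₁, …, bᵣ` for the matrix `B` such that, for every
`W`, only the zero functional of this space vanishes on all inputs generated by the keys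
(`exists_linearIndependent_forall_dual_eq_zero`). By duality, what the messages contribute to the
observation on `W` can be contributed by keys as well (`exists_forall_apply_eq_of_dual`), so changing
the messages amounts to shifting the uniform keys, and the observation is independent of the messages
and of every function of them (`mutualInfo_eq_zero_of_shift`).
-/

/-! ### Avoiding proper subspaces over a small field -/

/-- A subspace is not covered by at most `|F|` subspaces that do not contain it. If `x` avoids all
but the last of them and `y` avoids the last one, then, on the affine line `y + F x`, at most one
point lies in each of the former and, when `x` lies in the last one, none in the latter. -/
theorem Submodule.exists_mem_forall_notMem_of_card_le {F M ι : Type*} [Field F] [Fintype F]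
    [AddCommGroup M] [Module F M] (A : Submodule F M) (T : ι → Submodule F M) (I : Finset ι)
    (hI : I.card ≤ Fintype.card F) (hT : ∀ i ∈ I, ¬ A ≤ T i) :
    ∃ x ∈ A, ∀ i ∈ I, x ∉ T i := by
  classical
  induction I using Finset.induction_on with
  | empty => exact ⟨0, A.zero_mem, by simp⟩
  | insert a I ha ih =>
    rw [Finset.card_insert_of_notMem ha] at hI
    obtain ⟨x, hxA, hx⟩ := ih (by omega) fun i hi => hT i (Finset.mem_insert_of_mem hi)
    by_cases hxa : x ∈ T a
    swap
    · refine ⟨x, hxA, fun i hi => ?_⟩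
      rcases Finset.mem_insert.1 hi with rfl | hi
      exacts [hxa, hx i hi]
    obtain ⟨y, hyA, hya⟩ := SetLike.not_le_iff_exists.1 (hT a (Finset.mem_insert_self a I))
    by_contra! hcon
    have hbad : ∀ c : F, ∃ i ∈ I, y + c • x ∈ T i := by
      intro c
      obtain ⟨i, hi, hci⟩ := hcon (y + c • x) (A.add_mem hyA (A.smul_mem c hxA))
      rcases Finset.mem_insert.1 hi with rfl | hi
      · exact absurd ((Submodule.add_mem_iff_left _ ((T i).smul_mem c hxa)).1 hci) hya
      · exact ⟨i, hi, hci⟩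
    choose p hpI hp using hbad
    obtain ⟨c, -, c', -, hcc, hpc⟩ := Finset.exists_ne_map_eq_of_card_lt_of_maps_to
      (s := (Finset.univ : Finset F)) (t := I) (f := p)
      (by rw [Finset.card_univ]; omega) (fun c _ => hpI c)
    have h1 : (c - c') • x ∈ T (p c) := by
      have h2 := (T (p c)).sub_mem (hp c) (hpc ▸ hp c')
      rwa [add_sub_add_left_eq_sub, ← sub_smul] at h2
    exact hx _ (hpI c) (((T (p c)).smul_mem_iff (sub_ne_zero.2 hcc)).1 h1)

namespace Network

/-! ### Edge vectors spanning at every source -/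

variable {V E : Type*} {s : ℕ}

theorem wellFounded_flip_feeds [Finite E] (N : Network V E s) :
    WellFounded fun e d => N.Feeds d e := by
  have : IsTrans E (fun e d => Relation.TransGen N.Feeds d e) :=
    ⟨fun _ _ _ h h' => Relation.TransGen.trans h' h⟩
  have : Std.Irrefl (fun e d => Relation.TransGen N.Feeds d e) :=
    ⟨fun e h => N.feeds_wf.transGen.irrefl.irrefl e h⟩
  exact Subrelation.wf (fun h => Relation.TransGen.single h)
    (Finite.wellFounded_of_trans_of_irrefl fun e d => Relation.TransGen N.Feeds d e)

theorem exists_tail_eq_src (N : Network V E s) (i : Fin s) : ∃ e, N.tail e = N.src i := by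
  obtain ⟨_, ⟨e, he, -⟩, -⟩ :=
    Relation.TransGen.head'_iff.1 (N.reaches_sink _ (N.src_ne_sink i))
  exact ⟨e, he⟩

variable {F M : Type*} [Field F] [AddCommGroup M] [Module F M]

variable (F) in
/-- The span of the vectors on those edges of `S` whose tail lies in `X`. The heads of these edges
may lie in `X` as well. -/
def tailSpan (N : Network V E s) (h : E → M) (S : Finset E) (X : Finset V) : Submodule F M :=
  Submodule.span F (h '' {e | e ∈ S ∧ N.tail e ∈ X})

theorem tailSpan_mono (N : Network V E s) (h : E → M) (S : Finset E) {X Y : Finset V}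
    (hXY : X ⊆ Y) : N.tailSpan F h S X ≤ N.tailSpan F h S Y :=
  Submodule.span_mono (Set.image_mono fun _ he => ⟨he.1, hXY he.2⟩)

open Classical in
theorem tailSpan_union (N : Network V E s) (h : E → M) (S : Finset E) (X Y : Finset V) :
    N.tailSpan F h S (X ∪ Y) = N.tailSpan F h S X ⊔ N.tailSpan F h S Y := by
  rw [tailSpan, tailSpan, tailSpan, ← Submodule.span_union, ← Set.image_union]
  congr 2
  ext e
  simp [and_or_left]

variable (F) in
/-- The space in which the vector on `d` is chosen: the span of the vectors on the edges fed by `d`,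
or the whole space if `d` enters the sink. -/
def choiceSpace (N : Network V E s) (h : E → M) (d : E) : Submodule F M where
  carrier := {x | N.head d ≠ N.sink → x ∈ Submodule.span F (h '' {e | N.tail e = N.head d})}
  add_mem' ha hb hd := Submodule.add_mem _ (ha hd) (hb hd)
  zero_mem' _ := Submodule.zero_mem _
  smul_mem' r _ ha hd := Submodule.smul_mem _ r (ha hd)

theorem mem_choiceSpace {N : Network V E s} {h : E → M} {d : E} {x : M} : x ∈ choiceSpace F N h d ↔
    (N.head d ≠ N.sink → x ∈ Submodule.span F (h '' {e | N.tail e = N.head d})) := Iff.rfl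

variable [Fintype E]

open Classical in
/-- The edges outside `S` that leave the vertex set `X`. -/
noncomputable def openCut (N : Network V E s) (S : Finset E) (X : Finset V) : Finset E :=
  {e | e ∉ S ∧ N.tail e ∈ X ∧ N.head e ∉ X}

theorem cMin_le_card_openCut (N : Network V E s) {i : Fin s} {X : Finset V}
    (hi : N.src i ∈ X) (hX : N.sink ∉ X) : N.cMin ≤ (N.openCut ∅ X).card := by
  refine Nat.sInf_le ⟨_, ⟨i, fun hp => hX ?_⟩, rfl⟩
  have key : ∀ v, N.PathAvoiding (N.openCut ∅ X) (N.src i) v → v ∈ X := by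
    intro v hv
    have step : ∀ a b, a ∈ X → (∃ e, e ∉ N.openCut ∅ X ∧ N.tail e = a ∧ N.head e = b) →
        b ∈ X := by
      rintro a b ha ⟨e, he, rfl, rfl⟩
      by_contra hb
      exact he (by simp [openCut, ha, hb])
    induction hv with
    | single h => exact step _ _ hi h
    | tail _ h ih => exact step _ _ ih h
  exact key _ hp

open Classical in
theorem card_openCut_union_add_inter (N : Network V E s) (S : Finset E) (X Y : Finset V) :
    (N.openCut S (X ∪ Y)).card + (N.openCut S (X ∩ Y)).card ≤
      (N.openCut S X).card + (N.openCut S Y).card := by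
  simp only [openCut, Finset.card_filter, ← Finset.sum_add_distrib]
  refine Finset.sum_le_sum fun e _ => ?_
  simp only [Finset.mem_union, Finset.mem_inter]
  by_cases h1 : e ∈ S <;> by_cases h2 : N.tail e ∈ X <;> by_cases h3 : N.tail e ∈ Y <;>
    by_cases h4 : N.head e ∈ X <;> by_cases h5 : N.head e ∈ Y <;> simp [*]

variable (F) in
/-- The capacity of the vertex set `X` once vectors have been assigned to the edges of `S`: such an
edge is regarded as leading directly to the sink, and contributes through its vector only. -/
noncomputable def cutRank (N : Network V E s) (h : E → M) (S : Finset E) (X : Finset V) : ℕ :=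
  (N.openCut S X).card + Module.finrank F (N.tailSpan F h S X)

open Classical in
theorem cutRank_union_add_inter [FiniteDimensional F M] (N : Network V E s) (h : E → M)
    (S : Finset E) (X Y : Finset V) :
    N.cutRank F h S (X ∪ Y) + N.cutRank F h S (X ∩ Y) ≤
      N.cutRank F h S X + N.cutRank F h S Y := by
  have h1 := N.card_openCut_union_add_inter S X Y
  have h2 := Submodule.finrank_sup_add_finrank_inf_eq (N.tailSpan F h S X) (N.tailSpan F h S Y)
  have h3 : Module.finrank F (N.tailSpan F h S (X ∩ Y)) ≤
      Module.finrank F (N.tailSpan F h S X ⊓ N.tailSpan F h S Y : Submodule F M) :=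
    Submodule.finrank_mono (le_inf (N.tailSpan_mono h S Finset.inter_subset_left)
      (N.tailSpan_mono h S Finset.inter_subset_right))
  rw [← tailSpan_union] at h2
  unfold cutRank
  omega

variable (F) in
/-- A partial assignment of vectors, on a set `S` of edges that contains with an edge all edges fed
by it. The vector on an edge that does not enter the sink is spanned by those on the edges fed by
it, and every vertex set that separates a source from the sink still has capacity at least `c`. -/
structure IsPartialAssignment (N : Network V E s) (c : ℕ) (h : E → M) (S : Finset E) : Prop where
  closed : ∀ d ∈ S, ∀ e, N.Feeds d e → e ∈ S
  mem_span : ∀ d ∈ S, N.head d ≠ N.sink →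
    h d ∈ Submodule.span F (h '' {e | N.tail e = N.head d})
  le_cutRank : ∀ i X, N.src i ∈ X → N.sink ∉ X → c ≤ N.cutRank F h S X

section extend

variable {N : Network V E s} {c : ℕ} {h : E → M} {S : Finset E}

/-- The vertex sets that forbid certain vectors on the edge `d`: as `d` leaves `X` and the capacity of
`X` is only `c`, it drops below `c` if the vector chosen for `d` lies in `tailSpan F h S X`. -/
def IsCritical (N : Network V E s) (F : Type*) [Field F] [Module F M] (c : ℕ) (h : E → M)
    (S : Finset E) (d : E) (i : Fin s) (X : Finset V) : Prop :=
  N.src i ∈ X ∧ N.sink ∉ X ∧ N.tail d ∈ X ∧ N.head d ∉ X ∧ N.cutRank F h S X ≤ c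

open Classical in
/-- A critical vertex set does not forbid the whole choice space: otherwise adding the head of the
edge to the set would give a set of too small a capacity. If the head is the sink, the span would be
the whole space, and together with the edge itself the capacity would exceed `c`. -/
theorem IsPartialAssignment.not_choiceSpace_le [FiniteDimensional F M]
    (hS : N.IsPartialAssignment F c h S) (hc : Module.finrank F M = c) {d : E} (hd : d ∉ S)
    (hdS : ∀ e, N.Feeds d e → e ∈ S) {i : Fin s} {X : Finset V}
    (hX : N.IsCritical F c h S d i X) : ¬ choiceSpace F N h d ≤ N.tailSpan F h S X := by
  obtain ⟨hi, hs, ht, hh, hr⟩ := hX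
  intro hle
  have hdX : d ∈ N.openCut S X := by simp [openCut, hd, ht, hh]
  have hpos : 0 < (N.openCut S X).card := Finset.card_pos.2 ⟨d, hdX⟩
  by_cases hsink : N.head d = N.sink
  · have htop : N.tailSpan F h S X = ⊤ := top_le_iff.1 fun x _ =>
      hle (mem_choiceSpace.2 fun hne => absurd hsink hne)
    rw [cutRank, htop, finrank_top] at hr
    omega
  · have hlow := hS.le_cutRank i (insert (N.head d) X) (Finset.mem_insert_of_mem hi)
      (by simp [hs, Ne.symm hsink])
    have h1 : N.openCut S (insert (N.head d) X) ⊆ (N.openCut S X).erase d := by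
      intro e he
      simp only [openCut, Finset.mem_filter, Finset.mem_univ, true_and, Finset.mem_insert,
        not_or] at he
      obtain ⟨heS, het, heh, hehX⟩ := he
      have het' : N.tail e ∈ X := het.resolve_left fun h' => heS (hdS e h'.symm)
      refine Finset.mem_erase.2 ⟨fun h' => heh (by rw [h']), ?_⟩
      simp [openCut, heS, het', hehX]
    have h2 : N.tailSpan F h S (insert (N.head d) X) ≤ N.tailSpan F h S X := by
      rw [tailSpan, Submodule.span_le]
      rintro _ ⟨e, ⟨heS, het⟩, rfl⟩
      rcases Finset.mem_insert.1 het with het | het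
      · exact hle (mem_choiceSpace.2 fun _ => Submodule.subset_span ⟨e, het, rfl⟩)
      · exact Submodule.subset_span ⟨e, ⟨heS, het⟩, rfl⟩
    have h3 := Finset.card_le_card h1
    rw [Finset.card_erase_of_mem hdX] at h3
    have h4 := Submodule.finrank_mono h2
    unfold cutRank at hlow hr
    omega

open Classical in
/-- For each source, a single subspace contains all vectors that are forbidden on `d`: by
submodularity of the capacity, critical sets are closed under unions, so there is a largest one. -/
theorem IsPartialAssignment.exists_forbidden [FiniteDimensional F M] [Fintype V]
    (hS : N.IsPartialAssignment F c h S) (hc : Module.finrank F M = c) {d : E} (hd : d ∉ S)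
    (hdS : ∀ e, N.Feeds d e → e ∈ S) (i : Fin s) (hi : ∃ X, N.IsCritical F c h S d i X) :
    ∃ T : Submodule F M, ¬ choiceSpace F N h d ≤ T ∧
      ∀ X, N.IsCritical F c h S d i X → N.tailSpan F h S X ≤ T := by
  obtain ⟨X, hX, hmax⟩ := Finset.exists_max_image
    ({X | N.IsCritical F c h S d i X} : Finset (Finset V)) Finset.card
    (by simpa [Finset.Nonempty] using hi)
  simp only [Finset.mem_filter, Finset.mem_univ, true_and] at hX hmax
  refine ⟨N.tailSpan F h S X, hS.not_choiceSpace_le hc hd hdS hX, fun Y hY => ?_⟩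
  obtain ⟨hX1, hX2, hX3, hX4, hX5⟩ := id hX
  obtain ⟨hY1, hY2, hY3, hY4, hY5⟩ := hY
  have hsub := N.cutRank_union_add_inter (F := F) h S X Y
  have hinter := hS.le_cutRank i (X ∩ Y) (Finset.mem_inter.2 ⟨hX1, hY1⟩) (by simp [hX2])
  have hcrit : N.IsCritical F c h S d i (X ∪ Y) :=
    ⟨by simp [hX1], by simp [hX2, hY2], by simp [hX3], by simp [hX4, hY4], by omega⟩
  have heq : X = X ∪ Y :=
    Finset.eq_of_subset_of_card_le Finset.subset_union_left (hmax _ hcrit)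
  exact N.tailSpan_mono h S (heq ▸ Finset.subset_union_right)

open Classical in
theorem IsPartialAssignment.insert_update [FiniteDimensional F M]
    (hS : N.IsPartialAssignment F c h S) {d : E} (hd : d ∉ S)
    (hdS : ∀ e, N.Feeds d e → e ∈ S) {x : M} (hx : x ∈ choiceSpace F N h d)
    (hxT : ∀ i X, N.IsCritical F c h S d i X → x ∉ N.tailSpan F h S X) :
    N.IsPartialAssignment F c (Function.update h d x) (insert d S) := by
  have hupd : ∀ e ∈ S, Function.update h d x e = h e := fun e he =>
    Function.update_of_ne (ne_of_mem_of_not_mem he hd) _ _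
  have hclosed : ∀ d' ∈ insert d S, ∀ e, N.Feeds d' e → e ∈ S := by
    intro d' hd' e hf
    rcases Finset.mem_insert.1 hd' with rfl | hd'
    exacts [hdS e hf, hS.closed d' hd' e hf]
  refine ⟨fun d' hd' e hf => Finset.mem_insert_of_mem (hclosed d' hd' e hf), ?_, ?_⟩
  · intro d' hd' hne
    have himg : Function.update h d x '' {e | N.tail e = N.head d'} =
        h '' {e | N.tail e = N.head d'} :=
      Set.image_congr fun e he => hupd e (hclosed d' hd' e (Eq.symm he))
    rw [himg]
    rcases Finset.mem_insert.1 hd' with rfl | hd'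
    · rw [Function.update_self]
      exact mem_choiceSpace.1 hx hne
    · rw [hupd d' hd']
      exact hS.mem_span d' hd' hne
  · intro i X hi hX
    have hle : N.tailSpan F h S X ≤ N.tailSpan F (Function.update h d x) (insert d S) X := by
      rw [tailSpan, Submodule.span_le]
      rintro _ ⟨e, ⟨heS, het⟩, rfl⟩
      exact Submodule.subset_span ⟨e, ⟨Finset.mem_insert_of_mem heS, het⟩, hupd e heS⟩
    have hlow := hS.le_cutRank i X hi hX
    by_cases hcross : N.tail d ∈ X ∧ N.head d ∉ X
    · have hopen : (N.openCut S X).card ≤ (N.openCut (insert d S) X).card + 1 := by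
        have hsub : N.openCut S X ⊆ insert d (N.openCut (insert d S) X) := by
          intro e he
          simp only [openCut, Finset.mem_filter, Finset.mem_univ, true_and, Finset.mem_insert,
            not_or] at he ⊢
          tauto
        exact (Finset.card_le_card hsub).trans (Finset.card_insert_le _ _)
      by_cases hcrit : N.IsCritical F c h S d i X
      · have hlt : N.tailSpan F h S X <
            N.tailSpan F (Function.update h d x) (insert d S) X := by
          refine lt_of_le_of_ne hle fun heq => hxT i X hcrit ?_
          rw [heq]
          exact Submodule.subset_span
            ⟨d, ⟨Finset.mem_insert_self d S, hcross.1⟩, Function.update_self _ _ _⟩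
        have := Submodule.finrank_lt_finrank_of_lt hlt
        unfold cutRank at hlow ⊢
        omega
      · have hgt : c < N.cutRank F h S X := by
          by_contra hle'
          exact hcrit ⟨hi, hX, hcross.1, hcross.2, not_lt.1 hle'⟩
        have := Submodule.finrank_mono hle
        unfold cutRank at hgt ⊢
        omega
    · have hsub : N.openCut S X ⊆ N.openCut (insert d S) X := by
        intro e he
        simp only [openCut, Finset.mem_filter, Finset.mem_univ, true_and, Finset.mem_insert,
          not_or] at he ⊢
        refine ⟨⟨fun h' => hcross ?_, he.1⟩, he.2⟩
        rw [← h']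
        exact he.2
      have h1 := Finset.card_le_card hsub
      have h2 := Submodule.finrank_mono hle
      unfold cutRank at hlow ⊢
      omega

end extend

/-- The linear-algebraic form of the max-flow min-cut theorem for `s` simultaneous sources over a
field with at least `s` elements. Read from the sink to the sources, the vectors are the global
encoding vectors of a multicast code on the reversed network. -/
theorem exists_edge_vectors [Fintype V] [Fintype F] [FiniteDimensional F M] (N : Network V E s)
    (hs : s ≤ Fintype.card F) (hM : Module.finrank F M = N.cMin) :
    ∃ h : E → M,
      (∀ d, N.head d ≠ N.sink → h d ∈ Submodule.span F (h '' {e | N.tail e = N.head d})) ∧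
      ∀ i, Submodule.span F (h '' {e | N.tail e = N.src i}) = ⊤ := by
  classical
  have key : ∀ n ≤ Fintype.card E, ∃ (S : Finset E) (h : E → M),
      S.card = n ∧ N.IsPartialAssignment F N.cMin h S := by
    intro n
    induction n with
    | zero =>
      refine fun _ => ⟨∅, 0, rfl, by simp, by simp, fun i X hi hX => ?_⟩
      exact (N.cMin_le_card_openCut hi hX).trans (Nat.le_add_right _ _)
    | succ n ih =>
      intro hn
      obtain ⟨S, h, hcard, hS⟩ := ih (by omega)
      have hne : ({e | e ∉ S} : Set E).Nonempty := by
        by_contra hemp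
        have hall : S = Finset.univ := by
          ext e
          by_contra he
          exact hemp ⟨e, by simpa using he⟩
        rw [hall, Finset.card_univ] at hcard
        omega
      -- an edge outside `S` all of whose successors are in `S`
      obtain ⟨d, hd, hmin⟩ := N.wellFounded_flip_feeds.has_min _ hne
      have hdS : ∀ e, N.Feeds d e → e ∈ S := fun e he => by
        by_contra h'
        exact hmin e h' he
      have hT : ∀ i, ∃ T : Submodule F M, (∃ X, N.IsCritical F N.cMin h S d i X) →
          ¬ choiceSpace F N h d ≤ T ∧
            ∀ X, N.IsCritical F N.cMin h S d i X → N.tailSpan F h S X ≤ T := by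
        intro i
        by_cases hi : ∃ X, N.IsCritical F N.cMin h S d i X
        · obtain ⟨T, hT⟩ := hS.exists_forbidden hM hd hdS i hi
          exact ⟨T, fun _ => hT⟩
        · exact ⟨⊥, fun h' => absurd h' hi⟩
      choose T hT using hT
      obtain ⟨x, hx, hxT⟩ := (choiceSpace F N h d).exists_mem_forall_notMem_of_card_le T
        {i | ∃ X, N.IsCritical F N.cMin h S d i X}
        ((Finset.card_le_univ _).trans (by simpa using hs))
        (fun i hi => (hT i (by simpa using hi)).1)
      refine ⟨insert d S, Function.update h d x, by rw [Finset.card_insert_of_notMem hd, hcard],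
        hS.insert_update hd hdS hx fun i X hX hxX => ?_⟩
      exact hxT i (by simpa using ⟨X, hX⟩) ((hT i ⟨X, hX⟩).2 X hX hxX)
  obtain ⟨S, h, hcard, hS⟩ := key _ le_rfl
  obtain rfl : S = Finset.univ := (Finset.card_eq_iff_eq_univ S).1 hcard
  refine ⟨h, fun d => hS.mem_span d (Finset.mem_univ d), fun i => ?_⟩
  have hi := hS.le_cutRank i {N.src i} (by simp) (by simpa using (N.src_ne_sink i).symm)
  have h0 : N.openCut Finset.univ {N.src i} = ∅ := by simp [openCut]
  have h1 : N.tailSpan F h Finset.univ {N.src i} =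
      Submodule.span F (h '' {e | N.tail e = N.src i}) := by simp [tailSpan]
  rw [cutRank, h0, Finset.card_empty, zero_add, h1, ← hM] at hi
  exact Submodule.eq_top_of_finrank_eq (le_antisymm (Submodule.finrank_le _) hi)

end Network

namespace LinearCode

/-! ### A code that computes the sum -/

variable {V E : Type*} [Fintype E] {s : ℕ} {N : Network V E s} {F : Type*} [Field F]

/-- If the vectors `h e` are spanned by those on the edges fed by `e` and span the whole space at
every source, there is a code for which the sink computes the sum by weighting the symbol on `e`
with the vector `h e`: the local coefficients are those of the linear relations between the
vectors, so that the weighted sum telescopes from the sink back to the sources. -/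
theorem exists_decodable_of_edge_vectors {c : ℕ} (h : E → Fin c → F)
    (hh : ∀ d, N.head d ≠ N.sink → h d ∈ Submodule.span F (h '' {e | N.tail e = N.head d}))
    (hs : ∀ i, Submodule.span F (h '' {e | N.tail e = N.src i}) = ⊤) :
    ∃ C : LinearCode N F c 1 (fun _ => 0), C.Decodable fun x => ∑ i, x i := by
  classical
  have hcoeff : ∀ d, ∃ α : E → F, (N.head d = N.sink → ∀ e, α e = 0) ∧
      (N.head d ≠ N.sink → ∑ e with N.tail e = N.head d, α e • h e = h d) := by
    intro d
    by_cases hd : N.head d = N.sink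
    · exact ⟨0, fun _ _ => rfl, fun h' => absurd hd h'⟩
    · have hmem := hh d hd
      rw [← Finset.coe_filter_univ, Submodule.mem_span_image_finset_iff_exists_fun'] at hmem
      obtain ⟨α, hα⟩ := hmem
      exact ⟨α, fun h' => absurd h' hd, fun _ => hα⟩
  choose α hα₀ hα using hcoeff
  have hinj : ∀ i (p : Fin c), ∃ f : E → F,
      ∑ e with N.tail e = N.src i, f e • h e = Pi.single p 1 := by
    intro i p
    have hmem : (Pi.single p 1 : Fin c → F) ∈
        Submodule.span F (h '' {e | N.tail e = N.src i}) := by rw [hs]; trivial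
    rwa [← Finset.coe_filter_univ, Submodule.mem_span_image_finset_iff_exists_fun'] at hmem
  choose f hf using hinj
  let C : LinearCode N F c 1 (fun _ => 0) :=
    { msgCoeff := fun i p e _ => f i p e
      keyCoeff := fun _ p => p.elim0
      edgeCoeff := fun d e _ _ => α d e }
  refine ⟨C, fun y j => ∑ e : {e // N.head e = N.sink}, y e 0 * h e.1 j, fun m k => ?_⟩
  have hrec : ∀ e, C.edgeMsg m k e 0 = (∑ i with N.src i = N.tail e, ∑ p, m i p * f i p e) +
      ∑ d with N.head d = N.tail e, C.edgeMsg m k d 0 * α d e := by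
    intro e
    rw [edgeMsg_eq]
    simp only [Pi.add_apply, Finset.sum_apply, Pi.smul_apply, smul_eq_mul, Finset.univ_eq_empty,
      Finset.sum_empty, add_zero, Matrix.vecMul, dotProduct, Fin.sum_univ_one, C]
    congr 1
    exact (Finset.sum_subtype (p := fun d => N.Feeds d e) _ (by simp [Network.Feeds])
      (fun d => C.edgeMsg m k d 0 * α d e)).symm
  have htotal : ∑ e, C.edgeMsg m k e 0 • h e = ∑ i, m i +
      ∑ d with N.head d ≠ N.sink, C.edgeMsg m k d 0 • h d := by
    have h1 : ∑ e, (∑ i with N.src i = N.tail e, ∑ p, m i p * f i p e) • h e = ∑ i, m i := by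
      simp only [Finset.sum_filter, Finset.sum_smul]
      rw [Finset.sum_comm]
      refine Finset.sum_congr rfl fun i _ => ?_
      have : ∀ e, (if N.src i = N.tail e then ∑ p, m i p * f i p e else 0) • h e =
          ∑ p, m i p • (if N.tail e = N.src i then f i p e • h e else 0) := by
        intro e
        by_cases he : N.tail e = N.src i
        · simp [he, Finset.sum_smul, mul_smul]
        · simp [he, Ne.symm he]
      rw [Finset.sum_congr rfl fun e _ => this e, Finset.sum_comm]
      simp only [← Finset.smul_sum, ← Finset.sum_filter, hf]
      exact (pi_eq_sum_univ' (m i)).symm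
    have h2 : ∑ e, (∑ d with N.head d = N.tail e, C.edgeMsg m k d 0 * α d e) • h e =
        ∑ d with N.head d ≠ N.sink, C.edgeMsg m k d 0 • h d := by
      simp only [Finset.sum_filter, Finset.sum_smul]
      rw [Finset.sum_comm]
      refine Finset.sum_congr rfl fun d _ => ?_
      have : ∀ e, (if N.head d = N.tail e then C.edgeMsg m k d 0 * α d e else 0) • h e =
          C.edgeMsg m k d 0 • (if N.tail e = N.head d then α d e • h e else 0) := by
        intro e
        by_cases he : N.tail e = N.head d
        · simp [he, mul_smul]
        · simp [he, Ne.symm he]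
      rw [Finset.sum_congr rfl fun e _ => this e, ← Finset.smul_sum, ← Finset.sum_filter]
      by_cases hd : N.head d = N.sink
      · simp [hd, hα₀ d hd]
      · simp [hd, hα d hd]
    rw [← h1, ← h2, ← Finset.sum_add_distrib]
    exact Finset.sum_congr rfl fun e _ => by rw [hrec e, add_smul]
  rw [← Finset.sum_filter_add_sum_filter_not _ (fun e => N.head e = N.sink)] at htotal
  have hsink := add_right_cancel htotal
  funext j
  have hj := congrFun hsink j
  rw [Finset.sum_apply, Finset.sum_apply] at hj
  refine Eq.trans ?_ hj
  exact (Finset.sum_subtype (p := fun e => N.head e = N.sink) _ (by simp)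
    (fun e => C.edgeMsg m k e 0 * h e j)).symm

end LinearCode

/-! ### Choosing the key subspace -/

/-- Vectors `b₁, …, bᵣ` can be chosen one after another such that no nonzero functional from any of
the given spaces of dimension at most `r` vanishes on all vectors with components in their span.
While such functionals are left, all but a proper subspace of the vectors `bⱼ` exclude one of them,
and thereby lower the dimension of the space of those that are left. -/
theorem exists_linearIndependent_forall_dual_eq_zero {F M κ ι : Type*} [Field F] [Fintype F]
    [AddCommGroup M] [Module F M] [FiniteDimensional F M] [Fintype κ]
    [DecidableEq κ] (D : ι → Submodule F (Module.Dual F (κ → M))) (I : Finset ι)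
    (hI : I.card < Fintype.card F) {r : ℕ} (hr : r ≤ Module.finrank F M)
    (hD : ∀ w ∈ I, Module.finrank F (D w) ≤ r) :
    ∃ b : Fin r → M, LinearIndependent F b ∧
      ∀ w ∈ I, ∀ φ ∈ D w, (∀ i j, φ (Pi.single i (b j)) = 0) → φ = 0 := by
  classical
  -- the functionals in `D w` that are left after the choice of `b`
  let L : ι → (k : ℕ) → (Fin k → M) → Submodule F (Module.Dual F (κ → M)) := fun w k b =>
    D w ⊓ ⨅ i, ⨅ j, LinearMap.ker (Module.Dual.eval F (κ → M) (Pi.single i (b j)))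
  have hL : ∀ w k b φ, φ ∈ L w k b ↔ φ ∈ D w ∧ ∀ i j, φ (Pi.single i (b j)) = 0 := by
    intro w k b φ
    simp [L, Submodule.mem_iInf]
  suffices H : ∀ k ≤ r, ∃ b : Fin k → M, LinearIndependent F b ∧
      ∀ w ∈ I, Module.finrank F (L w k b) ≤ r - k by
    obtain ⟨b, hb, hbL⟩ := H r le_rfl
    refine ⟨b, hb, fun w hw φ hφ hφb => ?_⟩
    have h0 : L w r b = ⊥ := Submodule.finrank_eq_zero.1 (by have := hbL w hw; omega)
    have : φ ∈ L w r b := (hL _ _ _ _).2 ⟨hφ, hφb⟩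
    rwa [h0, Submodule.mem_bot] at this
  intro k
  induction k with
  | zero =>
    exact fun _ => ⟨Fin.elim0, linearIndependent_empty_type, fun w hw =>
      (Submodule.finrank_mono inf_le_left).trans (hD w hw)⟩
  | succ k ih =>
    intro hk
    obtain ⟨b, hb, hbL⟩ := ih (by omega)
    have hspan : Submodule.span F (Set.range b) ≠ ⊤ := by
      intro htop
      have h1 := finrank_range_le_card (R := F) b
      rw [Set.finrank, htop, finrank_top, Fintype.card_fin] at h1
      omega
    have hT : ∀ w, ∃ T : Submodule F M, T ≠ ⊤ ∧
        ∀ x ∉ T, L w k b ≠ ⊥ → ∃ φ ∈ L w k b, ∃ i, φ (Pi.single i x) ≠ 0 := by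
      intro w
      by_cases hw : L w k b = ⊥
      · exact ⟨_, hspan, fun _ _ h' => absurd hw h'⟩
      · obtain ⟨φ, hφ, hne⟩ := Submodule.exists_mem_ne_zero_of_ne_bot hw
        refine ⟨⨅ i, LinearMap.ker (φ ∘ₗ LinearMap.single F (fun _ : κ => M) i), fun htop => hne ?_,
          fun x hx _ => ⟨φ, hφ, ?_⟩⟩
        · refine LinearMap.pi_ext fun i x => ?_
          have hx : x ∈ ⨅ i, LinearMap.ker (φ ∘ₗ LinearMap.single F (fun _ : κ => M) i) := by
            rw [htop]; trivial
          simpa using (Submodule.mem_iInf _).1 hx i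
        · simpa [Submodule.mem_iInf] using hx
    choose T hTtop hT using hT
    -- besides the subspaces `T w`, the new vector avoids the span of the previous ones
    obtain ⟨x, -, hx⟩ := (⊤ : Submodule F M).exists_mem_forall_notMem_of_card_le
      (fun o : Option ι => o.elim (Submodule.span F (Set.range b)) T) (Finset.insertNone I)
      (by rw [Finset.card_insertNone]; omega)
      (by
        rintro (_ | w) - hle
        · exact hspan (top_le_iff.1 hle)
        · exact hTtop w (top_le_iff.1 hle))
    refine ⟨Fin.snoc b x, linearIndependent_finSnoc.2
      ⟨hb, hx none (by simp)⟩, fun w hw => ?_⟩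
    have hxw : x ∉ T w := hx (some w) (by simpa using hw)
    have hle : L w (k + 1) (Fin.snoc b x) ≤ L w k b := by
      intro φ hφ
      rw [hL] at hφ ⊢
      exact ⟨hφ.1, fun i j => by simpa using hφ.2 i j.castSucc⟩
    have hwk := hbL w hw
    by_cases hbot : L w k b = ⊥
    · rw [hbot, le_bot_iff] at hle
      rw [hle, finrank_bot]
      exact Nat.zero_le _
    · obtain ⟨φ, hφ, i, hi⟩ := hT w x hxw hbot
      have hlt : L w (k + 1) (Fin.snoc b x) < L w k b := by
        refine lt_of_le_of_ne hle fun heq => hi ?_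
        rw [← heq, hL] at hφ
        simpa using hφ.2 i (Fin.last k)
      have := Submodule.finrank_lt_finrank_of_lt hlt
      omega

/-- Prescribed linearly independent vectors are the last rows of some invertible matrix. -/
theorem LinearIndependent.exists_isUnit_matrix {F : Type*} [Field F] {c r : ℕ}
    {b : Fin r → Fin c → F} (hb : LinearIndependent F b) (hr : r ≤ c) :
    ∃ B : Matrix (Fin c) (Fin c) F, IsUnit B ∧
      ∀ j, B (Fin.cast (Nat.sub_add_cancel hr) (Fin.natAdd (c - r) j)) = b j := by
  obtain ⟨K, hK⟩ := Submodule.exists_isCompl (Submodule.span F (Set.range b))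
  have hKr : Module.finrank F K = c - r := by
    have h1 := Submodule.finrank_add_eq_of_isCompl hK
    rw [finrank_span_eq_card hb, Module.finrank_fin_fun, Fintype.card_fin] at h1
    omega
  let a := Module.finBasisOfFinrankEq F K hKr
  have hli : LinearIndependent F (Sum.elim (fun j => (a j : Fin c → F)) b) := by
    refine LinearIndependent.sum_type (a.linearIndependent.map' K.subtype K.ker_subtype) hb ?_
    refine hK.symm.disjoint.mono_left (Submodule.span_le.2 ?_)
    rintro _ ⟨j, rfl⟩
    exact (a j).2
  let e : Fin c ≃ Fin (c - r) ⊕ Fin r :=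
    (finCongr (Nat.sub_add_cancel hr).symm).trans finSumFinEquiv.symm
  refine ⟨Matrix.of (Sum.elim (fun j => (a j : Fin c → F)) b ∘ e), ?_, fun j => ?_⟩
  · exact Matrix.linearIndependent_rows_iff_isUnit.1 (hli.comp e e.injective)
  · change Sum.elim (fun j => (a j : Fin c → F)) b (e _) = b j
    have : e (Fin.cast (Nat.sub_add_cancel hr) (Fin.natAdd (c - r) j)) = Sum.inr j := by
      simp [e]
    rw [this, Sum.elim_inr]

/-! ### Vanishing mutual information by counting -/

open Classical in
theorem PMF.toReal_map_uniformOfFintype_apply {Ω α : Type*} [Fintype Ω] [Nonempty Ω]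
    (X : Ω → α) (x : α) :
    (((PMF.uniformOfFintype Ω).map X) x).toReal =
      (Finset.univ.filter fun ω => X ω = x).card / (Fintype.card Ω : ℝ) := by
  rw [PMF.map_apply, tsum_fintype]
  simp only [PMF.uniformOfFintype_apply, eq_comm (a := x)]
  rw [← Finset.sum_filter, Finset.sum_const, nsmul_eq_mul, ENNReal.toReal_mul,
    ENNReal.toReal_natCast, ENNReal.toReal_inv, ENNReal.toReal_natCast, div_eq_mul_inv]

open Classical in
theorem mutualInfo_uniformOfFintype_eq_zero {Ω α β : Type*} [Fintype Ω] [Nonempty Ω] [Fintype α]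
    [Fintype β] (X : Ω → α) (Y : Ω → β)
    (h : ∀ x y, (Finset.univ.filter fun ω => X ω = x ∧ Y ω = y).card * Fintype.card Ω =
      (Finset.univ.filter fun ω => X ω = x).card * (Finset.univ.filter fun ω => Y ω = y).card) :
    mutualInfo (PMF.uniformOfFintype Ω) X Y = 0 := by
  refine Finset.sum_eq_zero fun x _ => Finset.sum_eq_zero fun y _ => ?_
  have hΩ : (Fintype.card Ω : ℝ) ≠ 0 := Nat.cast_ne_zero.2 Fintype.card_ne_zero
  have hxy : ((((PMF.uniformOfFintype Ω).map fun ω => (X ω, Y ω)) (x, y)).toReal : ℝ) =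
      (((PMF.uniformOfFintype Ω).map X) x).toReal *
        (((PMF.uniformOfFintype Ω).map Y) y).toReal := by
    simp only [PMF.toReal_map_uniformOfFintype_apply, Prod.mk.injEq]
    have h' := congrArg (Nat.cast (R := ℝ)) (h x y)
    push_cast at h'
    field_simp
    linarith
  rw [hxy]
  rcases eq_or_ne ((((PMF.uniformOfFintype Ω).map X) x).toReal *
    (((PMF.uniformOfFintype Ω).map Y) y).toReal) 0 with h0 | h0
  · rw [h0, zero_mul]
  · rw [div_self h0, Real.log_one, mul_zero]

open Classical in
/-- An observation that is masked by a uniform key, in the sense that changing the message amounts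
to shifting the key, is independent of every function of the message. -/
theorem mutualInfo_eq_zero_of_shift {A K α β : Type*} {_ : Fintype A} {_ : Fintype K}
    {_ : Fintype α} {_ : Fintype β} [Nonempty A] [AddGroup K] (Y : A × K → α) (S : A → β) (Z : K → α)
    (hY : ∀ m, ∃ k₀, ∀ k, Y (m, k) = Z (k + k₀)) :
    mutualInfo (PMF.uniformOfFintype (A × K)) Y (fun ω => S ω.1) = 0 := by
  have hcount : ∀ m y, (Finset.univ.filter fun k => Y (m, k) = y).card =
      (Finset.univ.filter fun k => Z k = y).card := by
    intro m y
    obtain ⟨k₀, hk₀⟩ := hY m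
    exact Finset.card_equiv (Equiv.addRight k₀) fun k => by simp [hk₀]
  refine mutualInfo_uniformOfFintype_eq_zero _ _ fun y x => ?_
  have h1 : (Finset.univ.filter fun ω : A × K => Y ω = y ∧ S ω.1 = x).card =
      (Finset.univ.filter fun m => S m = x).card *
        (Finset.univ.filter fun k => Z k = y).card := by
    rw [Finset.card_filter, Fintype.sum_prod_type, Finset.card_filter, Finset.sum_mul]
    refine Finset.sum_congr rfl fun m _ => ?_
    rw [← hcount m y, Finset.card_filter]
    by_cases hm : S m = x <;> simp [hm]
  have h2 : (Finset.univ.filter fun ω : A × K => Y ω = y).card =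
      Fintype.card A * (Finset.univ.filter fun k => Z k = y).card := by
    rw [Finset.card_filter, Fintype.sum_prod_type]
    simp only [← Finset.card_filter, hcount, Finset.sum_const, Finset.card_univ, smul_eq_mul]
  have h3 : (Finset.univ.filter fun ω : A × K => S ω.1 = x).card =
      (Finset.univ.filter fun m => S m = x).card * Fintype.card K := by
    rw [Finset.card_filter, Fintype.sum_prod_type, Finset.card_filter, Finset.sum_mul]
    exact Finset.sum_congr rfl fun m _ => by by_cases hm : S m = x <;> simp [hm]
  rw [h1, h2, h3, Fintype.card_prod]
  ring

/-! ### Adding keys to a code -/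

/-- If no nonzero combination of the functionals `u w` vanishes on all vectors with components
in the span of the `b j`, then the values of the `u w` at any vector are also attained at one of
these vectors. -/
theorem exists_forall_apply_eq_of_dual {F M κ W : Type*} [Field F] [AddCommGroup M] [Module F M]
    [Fintype κ] [DecidableEq κ] [Fintype W] {r : ℕ} (u : W → Module.Dual F (κ → M)) (b : Fin r → M)
    (h : ∀ φ ∈ Submodule.span F (Set.range u), (∀ i j, φ (Pi.single i (b j)) = 0) → φ = 0)
    (x : κ → M) : ∃ k : κ → Fin r → F, ∀ w, u w x = u w fun i => ∑ j, k i j • b j := by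
  classical
  let R : (κ → Fin r → F) →ₗ[F] (W → F) :=
    LinearMap.pi fun w => u w ∘ₗ LinearMap.pi fun i =>
      Fintype.linearCombination F b ∘ₗ LinearMap.proj i
  have hR : ∀ k w, R k w = u w fun i => ∑ j, k i j • b j := fun k w => rfl
  suffices hx : (fun w => u w x) ∈ LinearMap.range R by
    obtain ⟨k, hk⟩ := hx
    exact ⟨k, fun w => by rw [← hR, hk]⟩
  by_contra hx
  obtain ⟨f, hfx, hf⟩ := Submodule.exists_le_ker_of_notMem hx
  have hfsum : ∀ v : W → F, f v = ∑ w, f (Pi.single w 1) * v w := by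
    intro v
    conv_lhs => rw [pi_eq_sum_univ' v]
    simp [mul_comm]
  have hφ : ∑ w, f (Pi.single w 1) • u w = 0 := by
    refine h _ (Submodule.sum_mem _ fun w _ => Submodule.smul_mem _ _
      (Submodule.subset_span ⟨w, rfl⟩)) fun i j => ?_
    have h0 : f (R (Pi.single i (Pi.single j 1))) = 0 := hf ⟨_, rfl⟩
    rw [hfsum] at h0
    have hsingle : (fun i' => ∑ j', (Pi.single i (Pi.single j 1) : κ → Fin r → F) i' j' • b j') =
        Pi.single i (b j) := by
      funext i'
      rcases eq_or_ne i' i with rfl | hne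
      · simp [Pi.single_apply]
      · simp [hne]
    simp only [hR, hsingle] at h0
    simpa using h0
  apply hfx
  rw [hfsum]
  simpa using congrArg (fun φ : Module.Dual F (κ → M) => φ x) hφ

theorem Matrix.vecMul_append {F : Type*} [Field F] {c r : ℕ} (hr : r ≤ c) (m : Fin (c - r) → F)
    (k : Fin r → F) (B : Matrix (Fin c) (Fin c) F) :
    Matrix.vecMul (Fin.append m k ∘ Fin.cast (Nat.sub_add_cancel hr).symm) B =
      ∑ j, m j • B (Fin.cast (Nat.sub_add_cancel hr) (Fin.castAdd r j)) +
      ∑ j, k j • B (Fin.cast (Nat.sub_add_cancel hr) (Fin.natAdd (c - r) j)) := by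
  rw [Matrix.vecMul_eq_sum, ← (finCongr (Nat.sub_add_cancel hr)).sum_comp, Fin.sum_univ_add]
  simp

namespace LinearCode

variable {V E : Type*} [Fintype E] {s : ℕ} {N : Network V E s} {F : Type*} [Field F]

theorem edgeMsg_add {ℓ n : ℕ} {z : Fin s → ℕ} (C : LinearCode N F ℓ n z)
    (m m' : Fin s → Fin ℓ → F) (k k' : (i : Fin s) → Fin (z i) → F) (e : E) :
    C.edgeMsg (m + m') (k + k') e = C.edgeMsg m k e + C.edgeMsg m' k' e := by
  induction e using N.feeds_wf.induction with
  | _ e ih =>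
    rw [edgeMsg_eq, edgeMsg_eq, edgeMsg_eq, add_add_add_comm, ← Finset.sum_add_distrib,
      ← Finset.sum_add_distrib]
    congr 1
    · refine Finset.sum_congr rfl fun i _ => ?_
      simp only [Pi.add_apply, add_smul, Finset.sum_add_distrib]
      exact add_add_add_comm _ _ _ _
    · exact Finset.sum_congr rfl fun d _ => by rw [ih d.1 d.2, Matrix.add_vecMul]

theorem edgeMsg_smul {ℓ n : ℕ} {z : Fin s → ℕ} (C : LinearCode N F ℓ n z) (a : F)
    (m : Fin s → Fin ℓ → F) (k : (i : Fin s) → Fin (z i) → F) (e : E) :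
    C.edgeMsg (a • m) (a • k) e = a • C.edgeMsg m k e := by
  induction e using N.feeds_wf.induction with
  | _ e ih =>
    rw [edgeMsg_eq, edgeMsg_eq, smul_add, Finset.smul_sum, Finset.smul_sum]
    congr 1
    · refine Finset.sum_congr rfl fun i _ => ?_
      simp only [Pi.smul_apply, smul_assoc, smul_add, Finset.smul_sum]
    · exact Finset.sum_congr rfl fun d _ => by rw [ih d.1 d.2, Matrix.smul_vecMul]

/-- The global encoding functional of the edge `e` of a scalar code without keys. -/
noncomputable def edgeFunctional {c : ℕ} (C : LinearCode N F c 1 fun _ => 0) (e : E) :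
    Module.Dual F (Fin s → Fin c → F) where
  toFun m := C.edgeMsg m (fun _ => Fin.elim0) e 0
  map_add' m m' := by
    rw [← Pi.add_apply, ← edgeMsg_add]
    congr
    exact funext fun i => Subsingleton.elim _ _
  map_smul' a m := by
    rw [RingHom.id_apply, ← Pi.smul_apply, ← edgeMsg_smul]
    congr
    exact funext fun i => Subsingleton.elim _ _

/-- The code in which every source feeds the vector `(mᵢ kᵢ) B` into the code `C`. -/
noncomputable def withKeys {c r : ℕ} (hr : r ≤ c) (C : LinearCode N F c 1 fun _ => 0)
    (B : Matrix (Fin c) (Fin c) F) : LinearCode N F (c - r) 1 fun _ => r where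
  msgCoeff i j e := ∑ p, B (Fin.cast (Nat.sub_add_cancel hr) (Fin.castAdd r j)) p •
    C.msgCoeff i p e
  keyCoeff i j e := ∑ p, B (Fin.cast (Nat.sub_add_cancel hr) (Fin.natAdd (c - r) j)) p •
    C.msgCoeff i p e
  edgeCoeff := C.edgeCoeff

theorem edgeMsg_withKeys {c r : ℕ} (hr : r ≤ c) (C : LinearCode N F c 1 fun _ => 0)
    (B : Matrix (Fin c) (Fin c) F) (m : Fin s → Fin (c - r) → F) (k : Fin s → Fin r → F) (e : E) :
    (C.withKeys hr B).edgeMsg m k e =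
      C.edgeMsg (fun i => Matrix.vecMul
        (Fin.append (m i) (k i) ∘ Fin.cast (Nat.sub_add_cancel hr).symm) B)
        (fun _ => Fin.elim0) e := by
  induction e using N.feeds_wf.induction with
  | _ e ih =>
    rw [edgeMsg_eq, edgeMsg_eq]
    congr 1
    · refine Finset.sum_congr rfl fun i _ => ?_
      rw [Finset.univ_eq_empty (α := Fin 0), Finset.sum_empty, add_zero]
      simp only [Matrix.vecMul_append hr, Pi.add_apply, Finset.sum_apply, Pi.smul_apply, add_smul,
        Finset.sum_add_distrib, Finset.sum_smul, withKeys, Finset.smul_sum, smul_assoc]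
      congr 1 <;> exact Finset.sum_comm
    · exact Finset.sum_congr rfl fun d _ => congrArg (Matrix.vecMul · (C.edgeCoeff d.1 e)) (ih d.1 d.2)

theorem Decodable.withKeys {c r : ℕ} (hr : r ≤ c) {C : LinearCode N F c 1 fun _ => 0}
    (hC : C.Decodable fun x => ∑ i, x i) {B : Matrix (Fin c) (Fin c) F} (hB : IsUnit B) :
    (C.withKeys hr B).Decodable fun x => ∑ i, x i := by
  obtain ⟨φ, hφ⟩ := hC
  refine ⟨fun y j => Matrix.vecMul (φ y) B⁻¹
    (Fin.cast (Nat.sub_add_cancel hr) (Fin.castAdd r j)), fun m k => ?_⟩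
  funext j
  simp only [edgeMsg_withKeys, hφ]
  have hsum : (fun p => ∑ i, Matrix.vecMul
      (Fin.append (m i) (k i) ∘ Fin.cast (Nat.sub_add_cancel hr).symm) B p) =
      Matrix.vecMul (∑ i, Fin.append (m i) (k i) ∘ Fin.cast (Nat.sub_add_cancel hr).symm) B := by
    rw [Matrix.sum_vecMul]
    funext p
    rw [Finset.sum_apply]
  rw [hsum, Matrix.vecMul_vecMul, Matrix.mul_nonsing_inv B ((Matrix.isUnit_iff_isUnit_det B).1 hB),
    Matrix.vecMul_one]
  simp

/-- If the key rows of `B` leave no nonzero combination of the functionals of a wiretap set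
vanishing on the keys, then every message shifts the observation by an amount that some key can
produce as well, so the observation is independent of the messages. -/
theorem functionSecure_withKeys [Fintype F] {c r : ℕ} (hr : r ≤ c)
    (C : LinearCode N F c 1 fun _ => 0) (B : Matrix (Fin c) (Fin c) F) {Q : Type*} [Fintype Q]
    (g : (Fin s → F) → Q) (𝒲 : Finset (Finset E))
    (h : ∀ W ∈ 𝒲, ∀ φ ∈ Submodule.span F (C.edgeFunctional '' (W : Set E)),
      (∀ i j, φ (Pi.single i
        (B (Fin.cast (Nat.sub_add_cancel hr) (Fin.natAdd (c - r) j)))) = 0) → φ = 0) :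
    (C.withKeys hr B).FunctionSecure g 𝒲 := by
  intro W hW
  let b : Fin r → Fin c → F := fun j =>
    B (Fin.cast (Nat.sub_add_cancel hr) (Fin.natAdd (c - r) j))
  have hval : ∀ m k e, (C.withKeys hr B).edgeMsg m k e 0 =
      C.edgeFunctional e (fun i =>
        ∑ j, m i j • B (Fin.cast (Nat.sub_add_cancel hr) (Fin.castAdd r j))) +
      C.edgeFunctional e (fun i => ∑ j, k i j • b j) := by
    intro m k e
    rw [edgeMsg_withKeys, ← map_add]
    simp only [Matrix.vecMul_append hr]
    rfl
  have hshift : ∀ m : Fin s → Fin (c - r) → F, ∃ k₀ : Fin s → Fin r → F, ∀ k : Fin s → Fin r → F,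
      (fun e : {e // e ∈ W} => (C.withKeys hr B).edgeMsg m k e.1) =
        fun e _ => C.edgeFunctional e.1 fun i => ∑ j, (k + k₀) i j • b j := by
    intro m
    obtain ⟨k₀, hk₀⟩ := exists_forall_apply_eq_of_dual
      (fun e : {e // e ∈ W} => C.edgeFunctional e.1) b
      (by
        have hWφ := h W hW
        rwa [Set.image_eq_range] at hWφ)
      (fun i => ∑ j, m i j • B (Fin.cast (Nat.sub_add_cancel hr) (Fin.castAdd r j)))
    refine ⟨k₀, fun k => ?_⟩
    funext e t
    rw [Subsingleton.elim t 0, hval, hk₀ e, ← map_add]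
    congr 1
    funext i
    simp [add_smul, Finset.sum_add_distrib, add_comm]
  exact mutualInfo_eq_zero_of_shift
    (fun ω (e : {e // e ∈ W}) => (C.withKeys hr B).edgeMsg ω.1 ω.2 e.1)
    (fun m j => g fun i => m i j)
    (fun (k : Fin s → Fin r → F) e _ => C.edgeFunctional e.1 fun i => ∑ j, k i j • b j) hshift

end LinearCode

theorem Network.le_card_wiretapSets {V E : Type*} [Fintype E] {s : ℕ} (N : Network V E s)
    {r : ℕ} (hr : 1 ≤ r) : s ≤ (wiretapSets E r).card := by
  choose e he using N.exists_tail_eq_src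
  have hinj : Function.Injective fun i => ({e i} : Finset E) := fun i j hij =>
    N.src.injective (by rw [← he i, ← he j, Finset.singleton_injective hij])
  have := Finset.card_le_card_of_injOn (s := (Finset.univ : Finset (Fin s)))
    (t := wiretapSets E r) _ (fun i _ => by simpa [wiretapSets] using hr) hinj.injOn
  simpa using this

theorem mainTheorem3 {V E : Type*} [Fintype V] [Fintype E] {s : ℕ} (N : Network V E s)
    {F : Type*} [Field F] [Fintype F]
    {t : ℕ} (G : Matrix (Fin s) (Fin t) F) (hG : G ≠ 0)
    (r : ℕ) (hr : r ≤ N.cMin)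
    (hq : G.rank * (wiretapSets E r).card < Fintype.card F)
    (hq₀ : r = 0 → s ≤ Fintype.card F) :
    ∃ (C : LinearCode N F N.cMin 1 (fun _ => 0))
      (B : Matrix (Fin N.cMin) (Fin N.cMin) F)
      (C' : LinearCode N F (N.cMin - r) 1 (fun _ => r)),
      C'.Decodable (fun x => ∑ i, x i) ∧
      C'.FunctionSecure (fun x => Matrix.vecMul x G) (wiretapSets E r) ∧
      C.Decodable (fun x => ∑ i, x i) ∧
      IsUnit B ∧
      ∀ (m : Fin s → Fin (N.cMin - r) → F) (k : Fin s → Fin r → F) (e : E),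
        C'.edgeMsg m k e =
          C.edgeMsg
            (fun i => Matrix.vecMul
              (Fin.append (m i) (k i) ∘ Fin.cast (Nat.sub_add_cancel hr).symm) B)
            (fun _ => Fin.elim0) e := by
  have hrank : 1 ≤ G.rank := by
    rw [Nat.one_le_iff_ne_zero]
    intro h0
    refine hG (Matrix.ext fun i j => ?_)
    have hbot : LinearMap.range G.mulVecLin = ⊥ := Submodule.finrank_eq_zero.1 h0
    have h1 : G.mulVecLin (Pi.single j 1) = 0 := by
      rw [LinearMap.range_eq_bot.1 hbot, LinearMap.zero_apply]
    simpa using congrFun h1 i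
  have hW : (wiretapSets E r).card < Fintype.card F :=
    (Nat.le_mul_of_pos_left _ hrank).trans_lt hq
  have hs : s ≤ Fintype.card F := by
    rcases Nat.eq_zero_or_pos r with h0 | hpos
    · exact hq₀ h0
    · exact (N.le_card_wiretapSets hpos).trans hW.le
  obtain ⟨h, hh, hspan⟩ := N.exists_edge_vectors (F := F) (M := Fin N.cMin → F) hs
    (Module.finrank_fin_fun F)
  obtain ⟨C, hC⟩ := LinearCode.exists_decodable_of_edge_vectors h hh hspan
  obtain ⟨b, hb, hbW⟩ := exists_linearIndependent_forall_dual_eq_zero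
    (fun W : Finset E => Submodule.span F (C.edgeFunctional '' (W : Set E))) (wiretapSets E r) hW
    (r := r) (by rwa [Module.finrank_fin_fun]) fun W hWr => by
      classical
      have h1 := finrank_span_finset_le_card (R := F) (W.image C.edgeFunctional)
      rw [Finset.coe_image] at h1
      exact h1.trans (Finset.card_image_le.trans (by simpa [wiretapSets] using hWr))
  obtain ⟨B, hB, hBb⟩ := hb.exists_isUnit_matrix hr
  refine ⟨C, B, C.withKeys hr B, hC.withKeys hr hB, C.functionSecure_withKeys hr B _ _ ?_, hC, hB,
    C.edgeMsg_withKeys hr B⟩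
  simpa only [hBb] using hbW
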